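/- Let $k\ge 1$ be an integer and let $a<b$ be real numbers. Let $C^k[a,b]$ be the real vector space of all functions $f:[a,b]\to\mathbb{R}$ that have $k$ continuous derivatives (one-sided at the end points), endowed with the norm $\|f\|_\infty=\sup\{|f(x)| : x\in[a,b]\}$, let $X=(C^k[a,b],\|\cdot\|_\infty)$, and let $C=\{f\in X : f(x)\ge 0 \text{ for all } x\in[a,b]\}$. Let $X^*$ be the topological dual of $X$ with its dual norm, and let $C^*=\{\varphi\in X^* : \varphi(c)\ge 0 \text{ for all } c\in C\}$ be the dual cone of $C$. Then the normed space $X$ is not complete; the dual cone $C^*$ is quasi-generating, that is, $\overline{C^*-C^*}=X^*$ (closure in the norm of $X^*$); and the origin is not a point of continuity for $C$, that is, the identity map from $C$ with the weak topology of $X$ to $C$ with the norm topology is not continuous at $0$. -/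

import Mathlib

open scoped Pointwise

noncomputable section

/-- `C^k[a,b]`: the real functions on `[a,b]` with `k` continuous derivatives (one-sided at the end
points), as a subspace of `C([a,b], ℝ)`. -/
def CkSubmodule (k : ℕ) (a b : ℝ) : Submodule ℝ C(Set.Icc a b, ℝ) where
  carrier := {f | ∃ g : ℝ → ℝ, ContDiffOn ℝ k g (Set.Icc a b) ∧ ∀ x : Set.Icc a b, f x = g x}
  add_mem' := by
    rintro f₁ f₂ ⟨g₁, h₁, e₁⟩ ⟨g₂, h₂, e₂⟩
    exact ⟨fun x => g₁ x + g₂ x, h₁.add h₂, fun x => by simp [e₁, e₂]⟩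
  zero_mem' := ⟨fun _ => 0, contDiffOn_const, fun _ => rfl⟩
  smul_mem' := by
    rintro c f ⟨g, h, e⟩
    exact ⟨fun x => c * g x, contDiffOn_const.mul h, fun x => by simp [e]⟩

/-- The normed space `(C^k[a,b], ‖·‖_∞)`, where `‖f‖_∞ = sup {|f x| : x ∈ [a,b]}` is the norm
inherited from `C([a,b], ℝ)`. -/
def CkSpace (k : ℕ) (a b : ℝ) : Type := CkSubmodule k a b

instance (k : ℕ) (a b : ℝ) : NormedAddCommGroup (CkSpace k a b) :=
  inferInstanceAs (NormedAddCommGroup (CkSubmodule k a b))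

instance (k : ℕ) (a b : ℝ) : NormedSpace ℝ (CkSpace k a b) :=
  inferInstanceAs (NormedSpace ℝ (CkSubmodule k a b))

/-- The order cone `C^k[a,b]⁺` of the pointwise nonnegative functions. -/
def CkPositiveCone (k : ℕ) (a b : ℝ) : PointedCone ℝ (CkSpace k a b) where
  carrier := {f | ∀ x : Set.Icc a b, 0 ≤ (Subtype.val f : C(Set.Icc a b, ℝ)) x}
  add_mem' := fun {_ _} hf hg x => add_nonneg (hf x) (hg x)
  zero_mem' := fun _ => le_rfl
  smul_mem' := fun c _ hf x => mul_nonneg c.2 (hf x)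

section Cones

variable {X : Type*} [NormedAddCommGroup X] [NormedSpace ℝ X]

/-- The dual cone `C* = {φ ∈ X* : φ c ≥ 0 for all c ∈ C}`. -/
def dualConeOf (C : PointedCone ℝ X) : PointedCone ℝ (StrongDual ℝ X) where
  carrier := {φ | ∀ c ∈ C, 0 ≤ φ c}
  add_mem' := fun {_ _} hf hg c hc => add_nonneg (hf c hc) (hg c hc)
  zero_mem' := fun _ _ => le_rfl
  smul_mem' := fun r _ hf c hc => mul_nonneg r.2 (hf c hc)

/-- A cone is quasi-generating if `C - C` is norm dense. -/
def IsQuasiGenerating (C : PointedCone ℝ X) : Prop :=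
  closure ((C : Set X) - (C : Set X)) = Set.univ

/-- The cone `C` has a quasi-generating dual cone: `C* - C*` is norm dense in `X*`. -/
def HasQuasiGeneratingDual (C : PointedCone ℝ X) : Prop :=
  IsQuasiGenerating (dualConeOf C)

/-- `x ∈ A` is a point of continuity for `A` if the identity map `(A, weak) → (A, ‖·‖)` is
continuous at `x`. -/
def IsPointOfContinuity (A : Set X) (x : X) : Prop :=
  x ∈ A ∧ ContinuousWithinAt (fun y : WeakSpace ℝ X => (toWeakSpace ℝ X).symm y)
    (toWeakSpace ℝ X '' A) (toWeakSpace ℝ X x)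

end Cones

end

/-! Incompleteness: polynomials make `C^k[a,b]` dense in `C[a,b]`, but it misses `|x - m|`, so it is
not closed there. Dual cone: every bounded functional is outright a difference of two positive ones
(`exists_eq_sub_of_dual`). As `C^k[a,b]` need not be a lattice, positive parts are taken in `C[a,b]`
and enter only through the sublinear bound in Hahn–Banach. Discontinuity at `0`: the functions
`powDiff` lie in the cone and have partial sums at most `1`. A positive functional therefore sends
them to a summable series, so by the decomposition they are weakly null, yet their norms stay at
least `1/4`. -/

namespace CkSpace

variable {k : ℕ} {a b : ℝ}

/-- The inclusion of `C^k[a,b]` into `C([a,b], ℝ)`. -/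
def incl (k : ℕ) (a b : ℝ) : CkSpace k a b →ₗ[ℝ] C(Set.Icc a b, ℝ) :=
  (CkSubmodule k a b).subtype

/-- The restriction to `[a,b]` of a `C^k` function on the line. -/
def ofContDiff (a b : ℝ) (g : ℝ → ℝ) (hg : ContDiff ℝ k g) : CkSpace k a b :=
  ⟨⟨fun x => g x, hg.continuous.comp continuous_subtype_val⟩, g, hg.contDiffOn, fun _ => rfl⟩

@[simp]
theorem incl_ofContDiff (g : ℝ → ℝ) (hg : ContDiff ℝ k g) (x : Set.Icc a b) :
    incl k a b (ofContDiff a b g hg) x = g x := rfl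

theorem norm_incl (f : CkSpace k a b) : ‖incl k a b f‖ = ‖f‖ := rfl

theorem mem_positiveCone {f : CkSpace k a b} :
    f ∈ CkPositiveCone k a b ↔ ∀ x, 0 ≤ incl k a b f x := Iff.rfl

theorem mem_dualConeOf {X : Type*} [NormedAddCommGroup X] [NormedSpace ℝ X]
    {C : PointedCone ℝ X} {φ : StrongDual ℝ X} :
    φ ∈ dualConeOf C ↔ ∀ c ∈ C, 0 ≤ φ c := Iff.rfl

/-- `C^k[a,b]` is dense in `C([a,b], ℝ)`, since it contains the polynomials. -/
theorem dense_CkSubmodule (k : ℕ) (a b : ℝ) :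
    Dense (CkSubmodule k a b : Set C(Set.Icc a b, ℝ)) := by
  have h : ((polynomialFunctions (Set.Icc a b) : Subalgebra ℝ C(Set.Icc a b, ℝ)) :
      Set C(Set.Icc a b, ℝ)) ⊆ CkSubmodule k a b := by
    rintro _ ⟨p, -, rfl⟩
    exact ⟨fun x => p.eval x, by simpa using (p.contDiff_aeval (𝕜 := ℝ) k).contDiffOn,
      fun x => by simp⟩
  intro f
  exact closure_mono h (continuousMap_mem_polynomialFunctions_closure a b f)

/-- Since `m` is interior, a `C^k` representative would agree with the kink near `m` and be
differentiable there. -/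
theorem abs_sub_notMem_CkSubmodule (hk : 1 ≤ k) {m : ℝ} (hm : m ∈ Set.Ioo a b) :
    (⟨fun x => |(x : ℝ) - m|, by fun_prop⟩ : C(Set.Icc a b, ℝ)) ∉ CkSubmodule k a b := by
  rintro ⟨g, hg, h⟩
  have hnhds : Set.Icc a b ∈ nhds m := Icc_mem_nhds hm.1 hm.2
  have hd : DifferentiableAt ℝ g m :=
    (hg.contDiffAt hnhds).differentiableAt (by exact_mod_cast (by omega : k ≠ 0))
  have heq : (fun x => |x - m|) =ᶠ[nhds m] g := by
    filter_upwards [hnhds] with x hx using h ⟨x, hx⟩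
  have hd' : DifferentiableAt ℝ (fun x => |x - m|) m := heq.differentiableAt_iff.2 hd
  have hshift : DifferentiableAt ℝ (fun y : ℝ => y + m) 0 := by fun_prop
  have := DifferentiableAt.comp (0 : ℝ) (f := fun y : ℝ => y + m) (by simpa using hd') hshift
  refine not_differentiableAt_abs_zero (this.congr_of_eventuallyEq ?_)
  exact Filter.Eventually.of_forall fun y => by simp

theorem not_completeSpace (hk : 1 ≤ k) (hab : a < b) : ¬ CompleteSpace (CkSpace k a b) := by
  intro hc
  have hclosed : IsClosed (CkSubmodule k a b : Set C(Set.Icc a b, ℝ)) :=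
    (completeSpace_coe_iff_isComplete.1 (show CompleteSpace (CkSubmodule k a b) from hc)).isClosed
  have huniv := hclosed.closure_eq.symm.trans (dense_CkSubmodule k a b).closure_eq
  refine abs_sub_notMem_CkSubmodule (k := k) hk (m := (a + b) / 2) (a := a) (b := b)
    ⟨by linarith, by linarith⟩ ?_
  rw [← SetLike.mem_coe, huniv]
  trivial

/-- Every bounded functional is a difference of positive ones: apply the Hahn–Banach theorem to
`(f, -f) ↦ φ f`, dominated by the sublinear map `(f, g) ↦ ‖φ‖ * ‖f⁺ + g⁺‖`. -/
theorem exists_eq_sub_of_dual (φ : StrongDual ℝ (CkSpace k a b)) :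
    ∃ α ∈ dualConeOf (CkPositiveCone k a b), ∃ β ∈ dualConeOf (CkPositiveCone k a b),
      φ = α - β := by
  let E := CkSpace k a b
  let J := incl k a b
  let N : E × E → ℝ := fun p => ‖φ‖ * ‖(J p.1 ⊔ 0) + (J p.2 ⊔ 0)‖
  let D : Submodule ℝ (E × E) := LinearMap.ker (LinearMap.fst ℝ E E + LinearMap.snd ℝ E E)
  have hD : ∀ x : D, x.1.2 = -x.1.1 := fun x => by
    have := x.2
    simp only [D, LinearMap.mem_ker, LinearMap.add_apply, LinearMap.fst_apply,
      LinearMap.snd_apply] at this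
    exact (neg_eq_of_add_eq_zero_right this).symm
  let F : E × E →ₗ.[ℝ] ℝ := ⟨D, (φ : E →ₗ[ℝ] ℝ) ∘ₗ LinearMap.fst ℝ E E ∘ₗ D.subtype⟩
  obtain ⟨Φ, hΦ, hle⟩ := exists_extension_of_le_sublinear F N
    (by
      intro c hc x
      have : (J (c • x).1 ⊔ 0) + (J (c • x).2 ⊔ 0) = c • ((J x.1 ⊔ 0) + (J x.2 ⊔ 0)) := by
        ext t
        simp only [Prod.smul_fst, Prod.smul_snd, map_smul, ContinuousMap.add_apply,
          ContinuousMap.sup_apply, ContinuousMap.smul_apply, ContinuousMap.zero_apply, smul_eq_mul,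
          mul_add]
        rw [mul_max_of_nonneg _ _ hc.le, mul_max_of_nonneg _ _ hc.le, mul_zero]
      simp only [N]
      rw [this, norm_smul, Real.norm_of_nonneg hc.le]
      ring)
    (by
      intro x y
      simp only [N]
      rw [← mul_add]
      refine mul_le_mul_of_nonneg_left ?_ (norm_nonneg _)
      refine le_trans ?_ (norm_add_le _ _)
      refine (ContinuousMap.norm_le _ (norm_nonneg _)).2 fun t => ?_
      refine le_trans ?_ (ContinuousMap.norm_coe_le_norm _ t)
      rw [Real.norm_eq_abs, Real.norm_eq_abs]
      refine abs_le_abs_of_nonneg ?_ ?_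
      · simp only [ContinuousMap.add_apply, ContinuousMap.sup_apply, ContinuousMap.zero_apply]
        positivity
      · simp only [Prod.fst_add, Prod.snd_add, map_add, ContinuousMap.add_apply,
          ContinuousMap.sup_apply, ContinuousMap.zero_apply]
        grind)
    (by
      intro x
      change φ x.1.1 ≤ ‖φ‖ * ‖(J x.1.1 ⊔ 0) + (J x.1.2 ⊔ 0)‖
      refine (le_abs_self _).trans ((φ.le_opNorm _).trans ?_)
      refine mul_le_mul_of_nonneg_left ?_ (norm_nonneg _)
      -- On the antidiagonal the bound holds because `f⁺ + (-f)⁺ = |f|`.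
      rw [← norm_incl]
      refine (ContinuousMap.norm_le _ (norm_nonneg _)).2 fun t => ?_
      refine le_trans ?_ (ContinuousMap.norm_coe_le_norm _ t)
      rw [hD, map_neg, Real.norm_eq_abs, Real.norm_eq_abs]
      simp only [J, ContinuousMap.add_apply, ContinuousMap.sup_apply, ContinuousMap.neg_apply,
        ContinuousMap.zero_apply]
      grind)
  have hbound : ∀ f : E, ‖J f ⊔ 0‖ ≤ ‖f‖ := fun f => by
    rw [← norm_incl]
    refine (ContinuousMap.norm_le _ (norm_nonneg _)).2 fun t => ?_
    refine le_trans ?_ (ContinuousMap.norm_coe_le_norm _ t)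
    rw [Real.norm_eq_abs, Real.norm_eq_abs]
    simp only [J, ContinuousMap.sup_apply, ContinuousMap.zero_apply]
    grind
  -- Restricting `Φ` to either factor gives a positive functional: if `f ≥ 0` then `(-f)⁺ = 0`, so
  -- `Φ (ι (-f)) ≤ 0`.
  have key : ∀ ι : E →ₗ[ℝ] E × E, (∀ f, N (ι f) = ‖φ‖ * ‖J f ⊔ 0‖) →
      ∃ α ∈ dualConeOf (CkPositiveCone k a b), ∀ f, α f = Φ (ι f) := by
    intro ι hι
    have hΦι : ∀ f, Φ (ι f) ≤ ‖φ‖ * ‖J f ⊔ 0‖ := fun f => (hle _).trans (hι f).le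
    have hΦn : ∀ f, Φ (ι f) ≤ ‖φ‖ * ‖f‖ := fun f =>
      (hΦι f).trans (mul_le_mul_of_nonneg_left (hbound f) (norm_nonneg _))
    refine ⟨(Φ ∘ₗ ι).mkContinuous ‖φ‖ fun f => ?_, mem_dualConeOf.2 fun f hf => ?_, fun f => rfl⟩
    · refine abs_le.2 ⟨?_, hΦn f⟩
      have := hΦn (-f)
      rw [map_neg, map_neg, norm_neg] at this
      simp only [LinearMap.comp_apply]
      linarith
    · have hz : J (-f) ⊔ 0 = 0 := by
        ext t
        have := mem_positiveCone.1 hf t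
        simpa [J] using this
      have := hΦι (-f)
      rw [hz, norm_zero, mul_zero, map_neg, map_neg] at this
      simp only [LinearMap.mkContinuous_apply, LinearMap.comp_apply]
      linarith
  obtain ⟨α, hα, hα'⟩ := key (LinearMap.inl ℝ E E) fun f => by simp [N]
  obtain ⟨β, hβ, hβ'⟩ := key (LinearMap.inr ℝ E E) fun f => by simp [N]
  refine ⟨α, hα, β, hβ, ?_⟩
  ext f
  have hmem : ((f, -f) : E × E) ∈ D := by simp [D]
  have := hΦ ⟨(f, -f), hmem⟩
  change Φ (f, -f) = φ f at this
  rw [sub_apply, hα', hβ', ← map_sub, ← this]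
  simp

theorem hasQuasiGeneratingDual (k : ℕ) (a b : ℝ) :
    HasQuasiGeneratingDual (CkPositiveCone k a b) := by
  refine Set.eq_univ_of_forall fun φ => subset_closure ?_
  obtain ⟨α, hα, β, hβ, h⟩ := exists_eq_sub_of_dual φ
  exact ⟨α, hα, β, hβ, h.symm⟩

/-- The polynomials `u ^ 2ⁿ - u ^ 2ⁿ⁺¹`, where `u = (x - a) / (b - a)`; their partial sums
telescope. -/
noncomputable def powDiff (k : ℕ) (a b : ℝ) (n : ℕ) : CkSpace k a b :=
  ofContDiff a b (fun x => ((x - a) / (b - a)) ^ 2 ^ n - ((x - a) / (b - a)) ^ 2 ^ (n + 1))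
    (by fun_prop)

theorem div_mem_Icc (hab : a < b) (x : Set.Icc a b) :
    ((x : ℝ) - a) / (b - a) ∈ Set.Icc (0 : ℝ) 1 := by
  have hx := x.2
  have : 0 < b - a := sub_pos.2 hab
  exact ⟨div_nonneg (by linarith [hx.1]) this.le, (div_le_one this).2 (by linarith [hx.2])⟩

theorem powDiff_mem (hab : a < b) (n : ℕ) : powDiff k a b n ∈ CkPositiveCone k a b :=
  mem_positiveCone.2 fun x => by
    have h := div_mem_Icc hab x
    exact sub_nonneg.2 (pow_le_pow_of_le_one h.1 h.2 (Nat.pow_le_pow_right two_pos n.le_succ))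

theorem sum_powDiff_apply (n : ℕ) (x : Set.Icc a b) :
    incl k a b (∑ i ∈ Finset.range n, powDiff k a b i) x =
      ((x : ℝ) - a) / (b - a) - (((x : ℝ) - a) / (b - a)) ^ 2 ^ n := by
  simp only [map_sum, ContinuousMap.sum_apply, powDiff, incl_ofContDiff]
  rw [Finset.sum_range_sub', pow_zero, pow_one]

theorem quarter_le_norm_powDiff (hab : a < b) (n : ℕ) : 1 / 4 ≤ ‖powDiff k a b n‖ := by
  have hpos : 0 < b - a := sub_pos.2 hab
  -- Where `u ^ 2 ^ n = 1/2`, the next power is its square, and the difference is `1/2 - 1/4`.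
  obtain ⟨u, hu, hun⟩ : (1 / 2 : ℝ) ∈ (fun u : ℝ => u ^ 2 ^ n) '' Set.Icc 0 1 :=
    intermediate_value_Icc zero_le_one (by fun_prop) (by simp; norm_num)
  have hx : a + u * (b - a) ∈ Set.Icc a b := ⟨by nlinarith [hu.1], by nlinarith [hu.2]⟩
  have h := ContinuousMap.norm_coe_le_norm (incl k a b (powDiff k a b n)) ⟨_, hx⟩
  simp only at hun
  rw [norm_incl] at h
  refine le_trans ?_ h
  rw [powDiff, incl_ofContDiff,
    add_sub_cancel_left, mul_div_cancel_right₀ _ hpos.ne', pow_succ 2, pow_mul, hun]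
  norm_num

/-- The terms `α (powDiff k a b n)` are nonnegative with partial sums at most `α 1`, because the
telescoped sum `u - u ^ 2 ^ n` is at most `1`. -/
theorem tendsto_powDiff_of_mem_dualConeOf (hab : a < b) {α : StrongDual ℝ (CkSpace k a b)}
    (hα : α ∈ dualConeOf (CkPositiveCone k a b)) :
    Filter.Tendsto (fun n => α (powDiff k a b n)) Filter.atTop (nhds 0) := by
  let e : CkSpace k a b := ofContDiff a b (fun _ => 1) contDiff_const
  refine (summable_of_sum_range_le (c := α e) (fun n => hα _ (powDiff_mem hab n))
    fun n => ?_).tendsto_atTop_zero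
  rw [← map_sum, ← sub_nonneg, ← map_sub]
  refine hα _ (mem_positiveCone.2 fun x => ?_)
  have h := div_mem_Icc hab x
  rw [map_sub, ContinuousMap.sub_apply, sum_powDiff_apply, incl_ofContDiff]
  linarith [h.2, pow_nonneg h.1 (2 ^ n)]

theorem tendsto_toWeakSpace_powDiff (hab : a < b) :
    Filter.Tendsto (fun n => toWeakSpace ℝ (CkSpace k a b) (powDiff k a b n)) Filter.atTop
      (nhds (toWeakSpace ℝ (CkSpace k a b) 0)) := by
  -- The weak topology is by definition induced by all evaluations, so convergence is tested on each
  -- `φ`.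
  refine (Topology.IsInducing.tendsto_nhds_iff (g := fun (x : WeakSpace ℝ (CkSpace k a b))
    (φ : StrongDual ℝ (CkSpace k a b)) => φ ((toWeakSpace ℝ _).symm x)) ⟨rfl⟩).2
    (tendsto_pi_nhds.2 fun φ => ?_)
  obtain ⟨α, hα, β, hβ, rfl⟩ := exists_eq_sub_of_dual φ
  have := (tendsto_powDiff_of_mem_dualConeOf hab hα).sub
    (tendsto_powDiff_of_mem_dualConeOf hab hβ)
  simpa using this

theorem not_isPointOfContinuity_zero (hab : a < b) :
    ¬ IsPointOfContinuity (CkPositiveCone k a b : Set (CkSpace k a b)) 0 := by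
  rintro ⟨-, h⟩
  have hw := tendsto_nhdsWithin_iff.2 ⟨tendsto_toWeakSpace_powDiff (k := k) hab,
    Filter.Eventually.of_forall fun n => Set.mem_image_of_mem _ (powDiff_mem hab n)⟩
  have hlim : Filter.Tendsto (powDiff k a b) Filter.atTop (nhds 0) := by
    simpa [Function.comp_def] using h.tendsto.comp hw
  have := ge_of_tendsto' hlim.norm (quarter_le_norm_powDiff hab)
  norm_num at this

end CkSpace

theorem mainTheorem10 (k : ℕ) (hk : 1 ≤ k) (a b : ℝ) (hab : a < b) :
    ¬ CompleteSpace (CkSpace k a b) ∧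
    HasQuasiGeneratingDual (CkPositiveCone k a b) ∧
    ¬ IsPointOfContinuity (CkPositiveCone k a b : Set (CkSpace k a b)) 0 :=
  ⟨CkSpace.not_completeSpace hk hab, CkSpace.hasQuasiGeneratingDual k a b,
    CkSpace.not_isPointOfContinuity_zero hab⟩
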